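/- For a finite set $V$ of points in the Euclidean plane $\mathbb{R}^2$, let $S_E(V)$ be the number of $3$-point subsets of $V$ whose three pairwise distances are all equal (the equilateral triangles determined by $V$), and for an integer $n\ge 0$ let $S_E(n)$ be the maximum of $S_E(V)$ over all $n$-point subsets $V$ of the plane. Then, for every $n \ge 0$, every $n$-point subset of the plane determines at most $\lfloor (4n-1)(n-1)/18\rfloor$ equilateral triangles; that is, $$S_E(n)\le \left\lfloor \frac{(4n-1)(n-1)}{18}\right\rfloor .$$ Consequently $\limsup_{n\to\infty} S_E(n)/n^2\le 2/9$. The bound is never larger than the previously known bound $\lfloor (n-1)^2/4\rfloor$, and it is strictly smaller for every $n\ge 9$. -/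

import Mathlib

open Filter

/-- The Euclidean plane. -/
abbrev Plane : Type := EuclideanSpace ℝ (Fin 2)

/-- The pattern of the vertices of equilateral triangles: all 3-point subsets of the plane in which
all pairs of distinct points have the same distance. -/
def equilateralPattern : Set (Finset Plane) :=
  {P | P.card = 3 ∧ ∃ d : ℝ, ∀ x ∈ P, ∀ y ∈ P, x ≠ y → dist x y = d}

open Classical in
/-- The number of instances of a pattern `Q` (a class of finite subsets of the universe `U`) that
are contained in the finite set `V`. -/
noncomputable def patternCount {U : Type*} (Q : Set (Finset U)) (V : Finset U) : ℕ :=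
  (V.powerset.filter (fun P => P ∈ Q)).card

/-- The largest number of instances of `Q` that can be found in an `n`-point subset of `U`. The
supremum is an attained maximum when `U` is infinite, see `isGreatest_maxPatternCount`. -/
noncomputable def maxPatternCount {U : Type*} (Q : Set (Finset U)) (n : ℕ) : ℕ :=
  sSup {m : ℕ | ∃ V : Finset U, V.card = n ∧ patternCount Q V = m}

theorem isGreatest_maxPatternCount {U : Type*} [Infinite U] (Q : Set (Finset U)) (n : ℕ) :
    IsGreatest {m : ℕ | ∃ V : Finset U, V.card = n ∧ patternCount Q V = m}
      (maxPatternCount Q n) := by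
  classical
  have hb : BddAbove {m : ℕ | ∃ V : Finset U, V.card = n ∧ patternCount Q V = m} := by
    refine ⟨2 ^ n, ?_⟩
    rintro m ⟨V, hV, rfl⟩
    unfold patternCount
    refine (Finset.card_filter_le _ _).trans ?_
    rw [Finset.card_powerset, hV]
  obtain ⟨V, hV⟩ := Infinite.exists_subset_card_eq U n
  exact ⟨Nat.sSup_mem ⟨_, V, hV, rfl⟩ hb, fun m hm => le_csSup hb hm⟩

/-! Identify the plane with ℂ and let `ω` be a primitive sixth root of unity. Every equilateral
triangle is counted at each of its vertices `x` by a point `y` whose rotation by `ω` about `x` is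
the third vertex, so three times the number of triangles is at most the sum of the `vertexCount`s
(`three_mul_patternCount_le`). With `N + 1` points each `vertexCount` is trivially at most `N`; the
gain comes from points `x` far from the median.

Three lines through `x` at angles of 60° cut the plane into six sectors, permuted cyclically by the
rotation. Hence `vertexCount` is at most the sum of the minima of the counts in consecutive sectors,
and it loses from `N` whenever opposite sectors are unbalanced. `sum_min_add_rankWeight_le` turns
this loss into weights of the deviations of the three half-plane counts from `N / 2`.

The lines keep the same three directions for all `x`, chosen generic. In each direction the
half-plane counts are the ranks `0, …, N`, each occurring once, so the total weight does not depend
on the configuration; `le_sum_rankWeight` bounds it below. Summing over `x` (`sum_vertexCount_le`)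
gives the bound. -/

/-! ### The weight function and its three-term inequality -/

/-- A piecewise linear weight of the deviation `v` of a rank from the median. -/
noncomputable def rankWeight (N v : ℝ) : ℝ :=
  min (min (max 0 (18 * |v| - 4 * N)) (9 * |v|)) (8 * N)

theorem rankWeight_neg (N v : ℝ) : rankWeight N (-v) = rankWeight N v := by
  simp [rankWeight]

/-- The case of mixed signs, `c` standing for minus the number whose sign differs. If `p` or `q` is
at most `2N/9`, its weight vanishes and slope 9 suffices for the other two. -/
theorem rankWeight_add_add_le_of_nonneg {N c p q X : ℝ} (hc : 0 ≤ c) (hp : 0 ≤ p) (hq : 0 ≤ q)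
    (h1 : p + q ≤ X) (h2 : c - q ≤ X) (h3 : c - p ≤ X) :
    rankWeight N c + rankWeight N p + rankWeight N q ≤ 18 * X := by
  have lin : ∀ t : ℝ, 0 ≤ t → rankWeight N t ≤ 9 * t := fun t ht => by
    unfold rankWeight
    rw [abs_of_nonneg ht]
    exact (min_le_left _ _).trans (min_le_right _ _)
  have top : ∀ t : ℝ, rankWeight N t ≤ 8 * N := fun t => min_le_right _ _
  have low : ∀ t : ℝ, 0 ≤ t → 9 * t ≤ 2 * N → rankWeight N t ≤ 0 := fun t ht h => by
    unfold rankWeight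
    rw [abs_of_nonneg ht, max_eq_left (by linarith)]
    exact (min_le_left _ _).trans (min_le_left _ _)
  have mid : ∀ t : ℝ, 0 ≤ t → 2 * N ≤ 9 * t → rankWeight N t ≤ 18 * t - 4 * N := fun t ht h => by
    unfold rankWeight
    rw [abs_of_nonneg ht, max_eq_right (by linarith)]
    exact (min_le_left _ _).trans (min_le_left _ _)
  have lc := lin c hc
  have lp := lin p hp
  have lq := lin q hq
  rcases le_total (9 * q) (2 * N) with hq' | hq'
  · linarith [low q hq hq']
  rcases le_total (9 * p) (2 * N) with hp' | hp'
  · linarith [low p hp hp']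
  -- The cap `8N` on the weight of `c` cancels the two offsets `-4N`, leaving `18(p + q)`.
  linarith [mid q hq hq', mid p hp hp', top c]

theorem rankWeight_add_add_le {N p q r X : ℝ} (h1 : |p + q| ≤ X) (h2 : |q + r| ≤ X)
    (h3 : |r + p| ≤ X) :
    rankWeight N p + rankWeight N q + rankWeight N r ≤ 18 * X := by
  have lin : ∀ t : ℝ, rankWeight N t ≤ 9 * |t| := fun t =>
    (min_le_left _ _).trans (min_le_right _ _)
  have lp := lin p
  have lq := lin q
  have lr := lin r
  obtain ⟨h1a, h1b⟩ := abs_le.mp h1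
  obtain ⟨h2a, h2b⟩ := abs_le.mp h2
  obtain ⟨h3a, h3b⟩ := abs_le.mp h3
  have key := @rankWeight_add_add_le_of_nonneg N
  -- With equal signs, slope 9 gives at most `27X/2`; otherwise the number of exceptional sign plays
  -- the role of `c`.
  rcases le_total 0 p with hp | hp <;> rcases le_total 0 q with hq | hq <;>
    rcases le_total 0 r with hr | hr
  · rw [abs_of_nonneg hp] at lp; rw [abs_of_nonneg hq] at lq; rw [abs_of_nonneg hr] at lr
    linarith
  · have := @key (-r) p q X (by linarith) hp hq (by linarith) (by linarith) (by linarith)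
    rw [rankWeight_neg] at this; linarith
  · have := @key (-q) p r X (by linarith) hp hr (by linarith) (by linarith) (by linarith)
    rw [rankWeight_neg] at this; linarith
  · have := @key p (-q) (-r) X hp (by linarith) (by linarith) (by linarith) (by linarith)
      (by linarith)
    rw [rankWeight_neg, rankWeight_neg] at this; linarith
  · have := @key (-p) q r X (by linarith) hq hr (by linarith) (by linarith) (by linarith)
    rw [rankWeight_neg] at this; linarith
  · have := @key q (-p) (-r) X hq (by linarith) (by linarith) (by linarith) (by linarith)
      (by linarith)
    rw [rankWeight_neg, rankWeight_neg] at this; linarith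
  · have := @key r (-p) (-q) X hr (by linarith) (by linarith) (by linarith) (by linarith)
      (by linarith)
    rw [rankWeight_neg, rankWeight_neg] at this; linarith
  · rw [abs_of_nonpos hp] at lp; rw [abs_of_nonpos hq] at lq; rw [abs_of_nonpos hr] at lr
    linarith

/-- If six cyclically arranged sectors contain `a₀, …, a₅` points, the number of pairs of points in
consecutive sectors is controlled by the weights of the three half-plane counts. -/
theorem sum_min_add_rankWeight_le (N a₀ a₁ a₂ a₃ a₄ a₅ d : ℝ)
    (hN : a₀ + a₁ + a₂ + a₃ + a₄ + a₅ = N)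
    (hd : d ≤ min a₀ a₁ + min a₁ a₂ + min a₂ a₃ + min a₃ a₄ + min a₄ a₅ + min a₅ a₀) :
    36 * d + (rankWeight N (2 * (a₀ + a₁ + a₂) - N) + rankWeight N (2 * (a₁ + a₂ + a₃) - N) +
      rankWeight N (2 * (a₂ + a₃ + a₄) - N)) ≤ 36 * N := by
  have l0 := min_le_left a₀ a₁
  have l1 := min_le_left a₁ a₂
  have l2 := min_le_left a₂ a₃
  have l3 := min_le_left a₃ a₄
  have l4 := min_le_left a₄ a₅
  have l5 := min_le_left a₅ a₀
  have r0 := min_le_right a₀ a₁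
  have r1 := min_le_right a₁ a₂
  have r2 := min_le_right a₂ a₃
  have r3 := min_le_right a₃ a₄
  have r4 := min_le_right a₄ a₅
  have r5 := min_le_right a₅ a₀
  -- With the middle sign reversed, the pairwise sums are, up to sign, twice the differences of
  -- opposite sectors. Each such difference is at most `N - d`, since the variation around the cycle
  -- is twice `N` minus the sum of the minima.
  have := @rankWeight_add_add_le N (2 * (a₀ + a₁ + a₂) - N) (-(2 * (a₁ + a₂ + a₃) - N))
    (2 * (a₂ + a₃ + a₄) - N) (2 * (N - d)) (abs_le.mpr ⟨by linarith, by linarith⟩)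
    (abs_le.mpr ⟨by linarith, by linarith⟩) (abs_le.mpr ⟨by linarith, by linarith⟩)
  rw [rankWeight_neg] at this
  linarith

/-! ### Summing the weight over all ranks -/

theorem sum_range_two_mul_sub_add_two (φ : ℝ → ℝ) (hφ : ∀ v, φ (-v) = φ v) (M : ℕ) :
    ∑ i ∈ Finset.range (M + 2 + 1), φ (2 * (i : ℝ) - ((M + 2 : ℕ) : ℝ)) =
      (∑ i ∈ Finset.range (M + 1), φ (2 * (i : ℝ) - (M : ℝ))) + 2 * φ (M + 2) := by
  rw [Finset.sum_range_succ, Finset.sum_range_succ']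
  have h0 : φ (2 * ((0 : ℕ) : ℝ) - ((M + 2 : ℕ) : ℝ)) = φ (M + 2) := by
    rw [← hφ]; congr 1; push_cast; ring
  have h1 : φ (2 * ((M + 2 : ℕ) : ℝ) - ((M + 2 : ℕ) : ℝ)) = φ (M + 2) := by
    congr 1; push_cast; ring
  have h2 : ∀ i ∈ Finset.range (M + 1), φ (2 * ((i + 1 : ℕ) : ℝ) - ((M + 2 : ℕ) : ℝ)) =
      φ (2 * (i : ℝ) - (M : ℝ)) := fun i _ => by
    congr 1; push_cast; ring
  rw [h0, h1, Finset.sum_congr rfl h2]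
  ring

/-- Induction in steps of two: passing from `M` to `M + 2` only adds the two extreme terms. For `c ≤
M` this bound and that of `sum_hinge_le` differ by just `1/2`. -/
theorem le_sum_hinge (c : ℝ) (hc : 0 ≤ c) : ∀ M : ℕ,
    (max 0 ((M : ℝ) - c)) ^ 2 / 2 + max 0 ((M : ℝ) - c) ≤
      ∑ i ∈ Finset.range (M + 1), max 0 (|2 * (i : ℝ) - (M : ℝ)| - c)
  | 0 => by simp [hc]
  | 1 => by
    have e : ∑ i ∈ Finset.range (1 + 1), max 0 (|2 * (i : ℝ) - ((1 : ℕ) : ℝ)| - c) =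
        2 * max 0 (1 - c) := by
      norm_num [Finset.sum_range_succ]; ring
    rw [e]
    rcases max_cases (0 : ℝ) (1 - c) with ⟨h, _⟩ | ⟨h, _⟩ <;> push_cast <;> rw [h] <;> nlinarith
  | M + 2 => by
    have ih := le_sum_hinge c hc M
    rw [sum_range_two_mul_sub_add_two (fun v => max 0 (|v| - c)) (by simp)]
    simp only [abs_of_nonneg (by positivity : (0 : ℝ) ≤ (M : ℝ) + 2)]
    refine le_trans ?_ (add_le_add_left ih _)
    push_cast
    rcases max_cases (0 : ℝ) ((M : ℝ) + 2 - c) with ⟨h, _⟩ | ⟨h, _⟩ <;>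
      rcases max_cases (0 : ℝ) ((M : ℝ) - c) with ⟨h', _⟩ | ⟨h', _⟩ <;> rw [h, h'] <;> nlinarith

theorem sum_hinge_le (c : ℝ) (hc : 0 ≤ c) : ∀ M : ℕ,
    ∑ i ∈ Finset.range (M + 1), max 0 (|2 * (i : ℝ) - (M : ℝ)| - c) ≤
      (max 0 ((M : ℝ) + 1 - c)) ^ 2 / 2
  | 0 => by
    simp [hc]; positivity
  | 1 => by
    have e : ∑ i ∈ Finset.range (1 + 1), max 0 (|2 * (i : ℝ) - ((1 : ℕ) : ℝ)| - c) =
        2 * max 0 (1 - c) := by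
      norm_num [Finset.sum_range_succ]; ring
    rw [e]
    push_cast
    rcases max_cases (0 : ℝ) (1 - c) with ⟨h, _⟩ | ⟨h, _⟩ <;>
      rcases max_cases (0 : ℝ) (1 + 1 - c) with ⟨h', _⟩ | ⟨h', _⟩ <;> rw [h, h'] <;> nlinarith
  | M + 2 => by
    have ih := sum_hinge_le c hc M
    rw [sum_range_two_mul_sub_add_two (fun v => max 0 (|v| - c)) (by simp)]
    simp only [abs_of_nonneg (by positivity : (0 : ℝ) ≤ (M : ℝ) + 2)]
    refine le_trans (add_le_add_left ih _) ?_
    push_cast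
    rcases max_cases (0 : ℝ) ((M : ℝ) + 2 - c) with ⟨h, _⟩ | ⟨h, _⟩ <;>
      rcases max_cases (0 : ℝ) ((M : ℝ) + 1 - c) with ⟨h', _⟩ | ⟨h', _⟩ <;>
      rcases max_cases (0 : ℝ) ((M : ℝ) + 2 + 1 - c) with ⟨h'', _⟩ | ⟨h'', _⟩ <;>
      rw [h, h', h''] <;> nlinarith [sq_nonneg ((M : ℝ) + 1 - c)]

/-- As a function of `|v|` the weight has slopes 0, 18, 9, 0, changing at `2N/9`, `4N/9` and `8N/9`.
-/
theorem hinge_le_rankWeight {N v : ℝ} (hN : 0 ≤ N) :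
    18 * max 0 (|v| - 2 * N / 9) - 9 * max 0 (|v| - 4 * N / 9) - 9 * max 0 (|v| - 8 * N / 9) ≤
      rankWeight N v := by
  have := abs_nonneg v
  unfold rankWeight
  rcases max_cases (0 : ℝ) (|v| - 2 * N / 9) with ⟨h, _⟩ | ⟨h, _⟩ <;>
    rcases max_cases (0 : ℝ) (|v| - 4 * N / 9) with ⟨h', _⟩ | ⟨h', _⟩ <;>
    rcases max_cases (0 : ℝ) (|v| - 8 * N / 9) with ⟨h'', _⟩ | ⟨h'', _⟩ <;>
    rw [h, h', h''] <;>
    refine le_min (le_min ?_ ?_) ?_ <;>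
    first
      | linarith
      | exact le_trans (by linarith) (le_max_left _ _)
      | exact le_trans (by linarith) (le_max_right _ _)

theorem le_sum_rankWeight (N : ℕ) : (N : ℝ) * (4 * N + 6) ≤
    ∑ i ∈ Finset.range (N + 1), rankWeight N (2 * (i : ℝ) - (N : ℝ)) := by
  -- The hinge estimates yield `4N² + 8N - 9`, which reaches `4N² + 6N` only from `N = 5` on.
  rcases Nat.lt_or_ge N 5 with h | h
  · interval_cases N <;> norm_num [Finset.sum_range_succ, rankWeight]
  · have hN : (5 : ℝ) ≤ N := by exact_mod_cast h
    have h1 := Finset.sum_le_sum (s := Finset.range (N + 1)) fun i _ =>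
      hinge_le_rankWeight (N := N) (v := 2 * (i : ℝ) - (N : ℝ)) (by positivity)
    rw [Finset.sum_sub_distrib, Finset.sum_sub_distrib, ← Finset.mul_sum, ← Finset.mul_sum,
      ← Finset.mul_sum] at h1
    have h2 := le_sum_hinge (2 * N / 9) (by positivity) N
    have h3 := sum_hinge_le (4 * N / 9) (by positivity) N
    have h4 := sum_hinge_le (8 * N / 9) (by positivity) N
    rw [max_eq_right (by linarith)] at h2 h3 h4
    nlinarith

/-- The number of points above `x` is strictly decreasing in `f x`, so it takes each value below
`V.card` exactly once. -/
theorem sum_rank {α : Type*} (V : Finset α) (f : α → ℝ) (hf : Set.InjOn f V) (φ : ℕ → ℝ) :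
    ∑ x ∈ V, φ (V.filter fun y => f x < f y).card = ∑ i ∈ Finset.range V.card, φ i := by
  classical
  have hlt : ∀ x ∈ V, ∀ y ∈ V, f x < f y →
      (V.filter fun z => f y < f z).card < (V.filter fun z => f x < f z).card := by
    intro x hx y hy hxy
    refine Finset.card_lt_card (Finset.ssubset_iff_of_subset ?_ |>.mpr ⟨y, ?_, ?_⟩)
    · intro z hz
      rw [Finset.mem_filter] at hz ⊢
      exact ⟨hz.1, hxy.trans hz.2⟩
    · simp [hy, hxy]
    · simp
  have hinj : Set.InjOn (fun x => (V.filter fun y => f x < f y).card) V := by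
    intro x hx y hy hxy
    by_contra hne
    rcases lt_or_gt_of_ne (fun h => hne (hf hx hy h)) with h | h
    · exact (hlt x hx y hy h).ne' hxy
    · exact (hlt y hy x hx h).ne hxy
  have himg : V.image (fun x => (V.filter fun y => f x < f y).card) = Finset.range V.card := by
    refine Finset.eq_of_subset_of_card_le ?_ ?_
    · intro k hk
      obtain ⟨x, hx, rfl⟩ := Finset.mem_image.mp hk
      refine Finset.mem_range.mpr (Finset.card_lt_card
        (Finset.ssubset_iff_of_subset (Finset.filter_subset _ _) |>.mpr ⟨x, hx, ?_⟩))
      simp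
    · rw [Finset.card_image_of_injOn hinj, Finset.card_range]
  rw [← himg, Finset.sum_image hinj]

/-! ### The six sectors around a point -/

/-- The values at angles `0, π/3, …, 5π/3` of a trigonometric function with values `a, b` at the
first two. -/
def hexValue (a b : ℝ) : Fin 6 → ℝ := ![a, b, b - a, -a, -b, a - b]

/-- The open sector number `k` of the plane, in the coordinates given by two linear functionals. -/
def InSector (a b : ℝ) (k : Fin 6) : Prop := 0 < hexValue a b k ∧ hexValue a b (k + 1) < 0

/-- Replacing `(a, b)` by `(a - b, a)` shifts `hexValue` cyclically by one place; this is the effect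
of multiplication by `ω` on the two functionals. -/
theorem inSector_rotate {a b : ℝ} (k : Fin 6) (h : InSector a b k) :
    InSector (a - b) a (k + 1) := by
  unfold InSector hexValue at *
  fin_cases k <;> simp at h ⊢ <;> constructor <;> linarith

theorem exists_inSector {a b : ℝ} (ha : a ≠ 0) (hb : b ≠ 0) (hab : a ≠ b) :
    ∃ k, InSector a b k := by
  unfold InSector hexValue
  rcases lt_or_gt_of_ne ha with ha | ha <;> rcases lt_or_gt_of_ne hb with hb | hb <;>
    rcases lt_or_gt_of_ne hab with hab | hab
  · exact ⟨4, by simp; constructor <;> linarith⟩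
  · exact ⟨5, by simp; constructor <;> linarith⟩
  · exact ⟨3, by simp; constructor <;> linarith⟩
  · linarith
  · linarith
  · exact ⟨0, by simp; constructor <;> linarith⟩
  · exact ⟨2, by simp; constructor <;> linarith⟩
  · exact ⟨1, by simp; constructor <;> linarith⟩

open Classical in
/-- The number of positively oriented equilateral triangles of `V` with a given vertex, where `ω`
stands for the primitive sixth root of unity. -/
noncomputable def vertexCount (ω : ℂ) (V : Finset ℂ) (x : ℂ) : ℕ :=
  (V.filter fun y => y ≠ x ∧ x + ω * (y - x) ∈ V).card

open Classical in
theorem vertexCount_add_rankWeight_le {ω : ℂ} (hω : ω ≠ 0) (V : Finset ℂ) {x : ℂ} (hx : x ∈ V)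
    (f g : ℂ → ℝ) (hf0 : f 0 = 0) (hg0 : g 0 = 0) (hf : ∀ z, f (ω * z) = f z - g z)
    (hg : ∀ z, g (ω * z) = f z)
    (hgen : ∀ y ∈ V, y ≠ x → f (y - x) ≠ 0 ∧ g (y - x) ≠ 0 ∧ f (y - x) ≠ g (y - x))
    {N : ℝ} (hN : (V.card : ℝ) = N + 1) :
    36 * (vertexCount ω V x : ℝ) +
      (rankWeight N (2 * ((V.filter fun y => 0 < f (y - x)).card : ℝ) - N) +
       rankWeight N (2 * ((V.filter fun y => 0 < g (y - x)).card : ℝ) - N) +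
       rankWeight N (2 * ((V.filter fun y => 0 < g (y - x) - f (y - x)).card : ℝ) - N)) ≤
      36 * N := by
  set A : Fin 6 → Finset ℂ := fun k => V.filter fun y => InSector (f (y - x)) (g (y - x)) k
    with hA
  set D := V.filter fun y => y ≠ x ∧ x + ω * (y - x) ∈ V with hD
  have hDsub : D ⊆ Finset.univ.biUnion fun k => D ∩ A k := by
    intro y hy
    have hy' := Finset.mem_filter.mp hy
    obtain ⟨h1, h2, h3⟩ := hgen y hy'.1 hy'.2.1
    obtain ⟨k, hk⟩ := exists_inSector h1 h2 h3
    exact Finset.mem_biUnion.mpr ⟨k, Finset.mem_univ _,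
      Finset.mem_inter.mpr ⟨hy, Finset.mem_filter.mpr ⟨hy'.1, hk⟩⟩⟩
  -- Rotation about `x` maps `D ∩ A k` injectively into `A (k + 1)`.
  have hmin : ∀ k, ((D ∩ A k).card : ℝ) ≤ min ((A k).card : ℝ) ((A (k + 1)).card : ℝ) := by
    intro k
    refine le_min (by exact_mod_cast Finset.card_le_card Finset.inter_subset_right) ?_
    refine Nat.cast_le.mpr (Finset.card_le_card_of_injOn (fun y => x + ω * (y - x)) ?_ ?_)
    · intro y hy
      obtain ⟨hyD, hyA⟩ := Finset.mem_inter.mp hy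
      refine Finset.mem_filter.mpr ⟨(Finset.mem_filter.mp hyD).2.2, ?_⟩
      have := inSector_rotate k (Finset.mem_filter.mp hyA).2
      rwa [← hf, ← hg (y - x), show ω * (y - x) = x + ω * (y - x) - x by ring] at this
    · intro y _ z _ hyz
      have := mul_left_cancel₀ hω (add_left_cancel hyz)
      exact sub_left_injective this
  have hdeg : (vertexCount ω V x : ℝ) ≤ ∑ k, min ((A k).card : ℝ) ((A (k + 1)).card : ℝ) := by
    have h1 : D.card ≤ ∑ k, (D ∩ A k).card :=
      (Finset.card_le_card hDsub).trans Finset.card_biUnion_le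
    calc (vertexCount ω V x : ℝ) ≤ ((∑ k, (D ∩ A k).card : ℕ) : ℝ) := by exact_mod_cast h1
      _ = ∑ k, ((D ∩ A k).card : ℝ) := by push_cast; rfl
      _ ≤ _ := Finset.sum_le_sum fun k _ => hmin k
  rw [Fin.sum_univ_six] at hdeg
  have hcard : ∀ p : ℂ → Prop, ((V.filter p).card : ℝ) = ∑ y ∈ V, if p y then (1 : ℝ) else 0 :=
    fun p => by simp
  have hsum : ((A 0).card : ℝ) + (A 1).card + (A 2).card + (A 3).card + (A 4).card + (A 5).card
      = N := by
    have h1 : ∑ y ∈ V, (1 - if y = x then (1 : ℝ) else 0) = N := by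
      simp [Finset.sum_sub_distrib, hx, hN]
    rw [← h1]
    simp only [hA, hcard, ← Finset.sum_add_distrib]
    refine Finset.sum_congr rfl fun y hy => ?_
    rcases eq_or_ne y x with rfl | hne
    · simp [InSector, hexValue, hf0, hg0]
    · obtain ⟨h1, h2, h3⟩ := hgen y hy hne
      rw [if_neg hne]
      simp only [InSector, hexValue]
      generalize f (y - x) = a at *
      generalize g (y - x) = b at *
      rcases lt_or_gt_of_ne h1 with ha | ha <;> rcases lt_or_gt_of_ne h2 with hb | hb <;>
        rcases lt_or_gt_of_ne h3 with hab | hab <;>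
        first
          | (exfalso; linarith)
          | simp [ha, hb, hab, ha.not_gt, hb.not_gt, hab.not_gt]
  -- Used for the three half-planes, each made up of three consecutive sectors.
  have hhalf : ∀ p : ℝ → ℝ → Prop, ∀ i j k : Fin 6, (¬ p 0 0) →
      (∀ a b : ℝ, a ≠ 0 → b ≠ 0 → a ≠ b → (if p a b then (1 : ℝ) else 0) =
        (if InSector a b i then 1 else 0) + (if InSector a b j then 1 else 0) +
        (if InSector a b k then 1 else 0)) →
      ((V.filter fun y => p (f (y - x)) (g (y - x))).card : ℝ) =
        (A i).card + (A j).card + (A k).card := by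
    intro p i j k hp h
    simp only [hA, hcard, ← Finset.sum_add_distrib]
    refine Finset.sum_congr rfl fun y hy => ?_
    rcases eq_or_ne y x with rfl | hne
    · have : ∀ l, ¬ InSector 0 0 l := fun l hl => by
        unfold InSector hexValue at hl
        fin_cases l <;> simp at hl
      simp [hf0, hg0, hp, this]
    · obtain ⟨h1, h2, h3⟩ := hgen y hy hne
      exact h _ _ h1 h2 h3
  have e1 := hhalf (fun a _ => 0 < a) 0 1 2 (by simp) (fun a b h1 h2 h3 => by
    simp only [InSector, hexValue]
    rcases lt_or_gt_of_ne h1 with ha | ha <;> rcases lt_or_gt_of_ne h2 with hb | hb <;>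
      rcases lt_or_gt_of_ne h3 with hab | hab <;>
      first
        | (exfalso; linarith)
        | simp [ha, hb, hab, ha.not_gt, hb.not_gt, hab.not_gt])
  have e2 := hhalf (fun _ b => 0 < b) 1 2 3 (by simp) (fun a b h1 h2 h3 => by
    simp only [InSector, hexValue]
    rcases lt_or_gt_of_ne h1 with ha | ha <;> rcases lt_or_gt_of_ne h2 with hb | hb <;>
      rcases lt_or_gt_of_ne h3 with hab | hab <;>
      first
        | (exfalso; linarith)
        | simp [ha, hb, hab, ha.not_gt, hb.not_gt, hab.not_gt])
  have e3 := hhalf (fun a b => 0 < b - a) 2 3 4 (by simp) (fun a b h1 h2 h3 => by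
    simp only [InSector, hexValue]
    rcases lt_or_gt_of_ne h1 with ha | ha <;> rcases lt_or_gt_of_ne h2 with hb | hb <;>
      rcases lt_or_gt_of_ne h3 with hab | hab <;>
      first
        | (exfalso; linarith)
        | simp [ha, hb, hab, ha.not_gt, hb.not_gt, hab.not_gt])
  rw [e1, e2, e3]
  exact sum_min_add_rankWeight_le N _ _ _ _ _ _ _ hsum hdeg

/-! ### A generic direction and the sum over all points -/

/-- A direction in which no two points of a finite set are aligned can be chosen outside finitely
many lines. -/
theorem exists_ne_zero_forall_im_mul_ne_zero (W : Finset ℂ) (hW : (0 : ℂ) ∉ W) :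
    ∃ u : ℂ, ∀ w ∈ W, (u * w).im ≠ 0 := by
  classical
  obtain ⟨t, ht⟩ := Infinite.exists_notMem_finset (W.image fun w => -w.im / w.re)
  refine ⟨⟨1, t⟩, fun w hw h => ?_⟩
  simp only [Complex.mul_im, one_mul] at h
  rcases eq_or_ne w.re 0 with hre | hre
  · rw [hre, mul_zero, add_zero] at h
    exact hW (by rwa [← show w = 0 from Complex.ext hre h])
  · refine ht (Finset.mem_image.mpr ⟨w, hw, ?_⟩)
    field_simp
    linarith

theorem sum_vertexCount_le {ω : ℂ} (hω : ω ^ 2 = ω - 1) (V : Finset ℂ) {N : ℕ}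
    (hN : V.card = N + 1) :
    6 * (∑ x ∈ V, (vertexCount ω V x : ℝ)) ≤ N * (4 * N + 3) := by
  classical
  have hω0 : ω ≠ 0 := by rintro rfl; norm_num at hω
  have hω1 : 1 - ω ≠ 0 := fun h => by
    rw [← sub_eq_zero.mp h] at hω; norm_num at hω
  set W := (V ×ˢ V).filter (fun p => p.2 ≠ p.1) |>.image fun p => p.2 - p.1 with hW
  -- The three families make `f`, `g` and `g - f` nonzero on all differences of distinct points.
  obtain ⟨u, hu⟩ := exists_ne_zero_forall_im_mul_ne_zero
    (W ∪ W.image (fun w => (1 - ω) * w) ∪ W.image (fun w => -ω * w)) (by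
      have h0 : ∀ w ∈ W, w ≠ 0 := by
        intro w hw
        obtain ⟨p, hp, rfl⟩ := Finset.mem_image.mp hw
        exact sub_ne_zero.mpr (Finset.mem_filter.mp hp).2
      intro h
      simp only [Finset.mem_union, Finset.mem_image] at h
      rcases h with (h | ⟨w, hw, h⟩) | ⟨w, hw, h⟩
      · exact h0 0 h rfl
      · exact mul_ne_zero hω1 (h0 w hw) h
      · exact mul_ne_zero (neg_ne_zero.mpr hω0) (h0 w hw) h)
  set f : ℂ → ℝ := fun z => (u * z).im with hf
  -- Here `1 - ω` is the inverse of `ω`, so `g` is `f` after the inverse rotation.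
  set g : ℂ → ℝ := fun z => (u * ((1 - ω) * z)).im with hg
  have hgf : ∀ z, g z - f z = (u * (-ω * z)).im := fun z => by
    simp only [hf, hg, ← Complex.sub_im]; congr 1; ring
  have hfω : ∀ z, f (ω * z) = f z - g z := fun z => by
    simp only [hf, hg, ← Complex.sub_im]; congr 1; ring
  have hgω : ∀ z, g (ω * z) = f z := fun z => by
    simp only [hf, hg]; congr 1; linear_combination (-u * z) * hω
  have hfsub : ∀ y x, f (y - x) = f y - f x := fun y x => by
    simp only [hf, ← Complex.sub_im]; congr 1; ring
  have hgsub : ∀ y x, g (y - x) = g y - g x := fun y x => by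
    simp only [hg, ← Complex.sub_im]; congr 1; ring
  have hgen : ∀ x ∈ V, ∀ y ∈ V, y ≠ x →
      f (y - x) ≠ 0 ∧ g (y - x) ≠ 0 ∧ f (y - x) ≠ g (y - x) := by
    intro x hx y hy hne
    have hw : y - x ∈ W := Finset.mem_image.mpr ⟨(x, y), by simp [hx, hy, hne], rfl⟩
    refine ⟨hu _ (by simp [hw]), hu _ ?_, fun h => hu (-ω * (y - x)) ?_ ?_⟩
    · exact Finset.mem_union_left _ (Finset.mem_union_right _ (Finset.mem_image_of_mem _ hw))
    · exact Finset.mem_union_right _ (Finset.mem_image_of_mem (fun w => -ω * w) hw)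
    · rw [← hgf, h, sub_self]
  have hpt := Finset.sum_le_sum fun x hx => vertexCount_add_rankWeight_le hω0 V hx f g
    (by simp [hf]) (by simp [hg]) hfω hgω (hgen x hx) (N := N) (by exact_mod_cast hN)
  have hinj : ∀ h : ℂ → ℝ, (∀ x ∈ V, ∀ y ∈ V, y ≠ x → h y - h x ≠ 0) → Set.InjOn h V :=
    fun h hh x hx y hy hxy => by
      by_contra hne
      exact hh x hx y hy (Ne.symm hne) (by rw [hxy, sub_self])
  have hrank : ∀ h : ℂ → ℝ, (∀ x ∈ V, ∀ y ∈ V, y ≠ x → h y - h x ≠ 0) →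
      (N : ℝ) * (4 * N + 6) ≤
        ∑ x ∈ V, rankWeight N (2 * ((V.filter fun y => h x < h y).card : ℝ) - N) := by
    intro h hh
    rw [sum_rank V h (hinj h hh) fun i => rankWeight N (2 * (i : ℝ) - N), hN]
    exact le_sum_rankWeight N
  have r1 := hrank f fun x hx y hy hne => hfsub y x ▸ (hgen x hx y hy hne).1
  have r2 := hrank g fun x hx y hy hne => hgsub y x ▸ (hgen x hx y hy hne).2.1
  have r3 := hrank (fun z => g z - f z) fun x hx y hy hne h => (hgen x hx y hy hne).2.2 (by
    rw [hfsub, hgsub]; linarith)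
  simp only [hfsub, hgsub, Finset.sum_add_distrib, ← Finset.mul_sum, Finset.sum_const,
    nsmul_eq_mul, hN, sub_pos] at hpt
  have e3 : ∀ x y, (f y - f x < g y - g x) ↔ (g x - f x < g y - f y) := fun x y => by
    constructor <;> intro h <;> linarith
  simp only [e3] at hpt
  push_cast at hpt
  -- With `S` the sum of the `vertexCount`s, `36S + 3N(4N + 6) ≤ 36N(N + 1)`.
  nlinarith

/-! ### From equilateral triangles to rotations -/

/-- The norm conditions force `v² - uv + u² = 0`, which factors over `ω` as `(v - ωu)(u - ωv) = 0`.
-/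
theorem eq_mul_or_eq_mul_of_norm_eq {ω u v : ℂ} (hω : ω ^ 2 = ω - 1) (hu : u ≠ 0)
    (h1 : ‖u‖ = ‖v‖) (h2 : ‖u‖ = ‖u - v‖) : v = ω * u ∨ u = ω * v := by
  have hq : v ^ 2 - u * v + u ^ 2 = 0 := by
    have e1 : Complex.normSq u = Complex.normSq v := by
      rw [Complex.normSq_eq_norm_sq, Complex.normSq_eq_norm_sq, h1]
    have e2 : Complex.normSq u = Complex.normSq (u - v) := by
      rw [Complex.normSq_eq_norm_sq, Complex.normSq_eq_norm_sq, h2]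
    have c1 : u * starRingEnd ℂ u = v * starRingEnd ℂ v := by
      rw [Complex.mul_conj, Complex.mul_conj, e1]
    have c2 : u * starRingEnd ℂ u = (u - v) * (starRingEnd ℂ u - starRingEnd ℂ v) := by
      rw [← map_sub, Complex.mul_conj, Complex.mul_conj, e2]
    have hu' : starRingEnd ℂ u ≠ 0 := (map_ne_zero _).mpr hu
    refine (mul_eq_zero.mp (?_ : starRingEnd ℂ u * (v ^ 2 - u * v + u ^ 2) = 0)).resolve_left hu'
    -- This combination eliminates the conjugate of `v`.
    linear_combination (u - v) * c1 + v * c2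
  have : (v - ω * u) * (u - ω * v) = 0 := by
    linear_combination (-ω) * hq + u * v * hω
  rcases mul_eq_zero.mp this with h | h
  · exact Or.inl (sub_eq_zero.mp h)
  · exact Or.inr (sub_eq_zero.mp h)

/-- Double counting of pairs of a triangle and a vertex `x`: one of the other two vertices rotates
about `x` to the third and thereby determines the triangle. -/
theorem three_mul_patternCount_le {ω : ℂ} (hω : ω ^ 2 = ω - 1) (e : Plane ≃ₗᵢ[ℝ] ℂ)
    (V : Finset Plane) :
    3 * patternCount equilateralPattern V ≤
      ∑ x ∈ V.map e.toEquiv.toEmbedding, vertexCount ω (V.map e.toEquiv.toEmbedding) x := by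
  classical
  set V' := V.map e.toEquiv.toEmbedding with hV'
  have hmem : ∀ x, e x ∈ V' ↔ x ∈ V := fun x => Finset.mem_map' e.toEquiv.toEmbedding
  set T := V.powerset.filter (fun P => P ∈ equilateralPattern) with hT
  have hcount : patternCount equilateralPattern V = T.card := by
    unfold patternCount
    congr
  have hvertex : ∀ x ∈ V, (T.filter fun P => x ∈ P).card ≤ vertexCount ω V' (e x) := by
    intro x hx
    refine (Finset.card_le_card ?_).trans (Finset.card_image_le (f := fun y : ℂ =>
      ({x, e.symm y, e.symm (e x + ω * (y - e x))} : Finset Plane)))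
    intro P hP
    obtain ⟨hPT, hxP⟩ := Finset.mem_filter.mp hP
    obtain ⟨hPV, hcard, d, hd⟩ := Finset.mem_filter.mp hPT
    rw [Finset.mem_powerset] at hPV
    obtain ⟨y, z, hyz, hPx⟩ := Finset.card_eq_two.mp
      (by rw [Finset.card_erase_of_mem hxP, hcard] : (P.erase x).card = 2)
    have hy : y ≠ x ∧ y ∈ P := Finset.mem_erase.mp (by rw [hPx]; simp)
    have hz : z ≠ x ∧ z ∈ P := Finset.mem_erase.mp (by rw [hPx]; simp)
    have hPeq : P = {x, y, z} := by rw [← Finset.insert_erase hxP, hPx]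
    have d1 : ‖e y - e x‖ = d := by
      rw [← map_sub, e.norm_map, ← dist_eq_norm]; exact hd y hy.2 x hxP hy.1
    have d2 : ‖e z - e x‖ = d := by
      rw [← map_sub, e.norm_map, ← dist_eq_norm]; exact hd z hz.2 x hxP hz.1
    have d3 : ‖e y - e x - (e z - e x)‖ = d := by
      rw [sub_sub_sub_cancel_right, ← map_sub, e.norm_map, ← dist_eq_norm]
      exact hd y hy.2 z hz.2 hyz
    rw [Finset.mem_image]
    rcases eq_mul_or_eq_mul_of_norm_eq hω (sub_ne_zero.mpr (e.injective.ne hy.1))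
      (d1.trans d2.symm) (d1.trans d3.symm) with h | h
    · have hez : e x + ω * (e y - e x) = e z := by rw [← h]; ring
      refine ⟨e y, Finset.mem_filter.mpr ⟨(hmem y).mpr (hPV hy.2), e.injective.ne hy.1, ?_⟩, ?_⟩
      · rw [hez]; exact (hmem z).mpr (hPV hz.2)
      · rw [hez, e.symm_apply_apply, e.symm_apply_apply, hPeq]
    · have hey : e x + ω * (e z - e x) = e y := by rw [← h]; ring
      refine ⟨e z, Finset.mem_filter.mpr ⟨(hmem z).mpr (hPV hz.2), e.injective.ne hz.1, ?_⟩, ?_⟩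
      · rw [hey]; exact (hmem y).mpr (hPV hy.2)
      · rw [hey, e.symm_apply_apply, e.symm_apply_apply, hPeq, Finset.pair_comm]
  calc 3 * patternCount equilateralPattern V = ∑ P ∈ T, P.card := by
        rw [hcount, Finset.sum_congr rfl fun P hP => (Finset.mem_filter.mp hP).2.1,
          Finset.sum_const, smul_eq_mul, mul_comm]
    _ = ∑ P ∈ T, (V.filter fun x => x ∈ P).card := by
        refine Finset.sum_congr rfl fun P hP => ?_
        rw [Finset.filter_mem_eq_inter, Finset.inter_eq_right.mpr
          (Finset.mem_powerset.mp (Finset.mem_filter.mp hP).1)]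
    _ = ∑ x ∈ V, (T.filter fun P => x ∈ P).card :=
        Finset.sum_card_bipartiteAbove_eq_sum_card_bipartiteBelow fun P x => x ∈ P
    _ ≤ ∑ x ∈ V, vertexCount ω V' (e x) := Finset.sum_le_sum hvertex
    _ = _ := by rw [hV', Finset.sum_map]; rfl

theorem patternCount_equilateralPattern_le (V : Finset Plane) :
    (patternCount equilateralPattern V : ℝ) ≤
      (4 * (V.card : ℝ) - 1) * ((V.card : ℝ) - 1) / 18 := by
  have hω : (⟨1 / 2, √3 / 2⟩ : ℂ) ^ 2 = ⟨1 / 2, √3 / 2⟩ - 1 := by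
    have h3 : √3 * √3 = 3 := Real.mul_self_sqrt (by norm_num)
    rw [sq]
    apply Complex.ext
    · simp only [Complex.mul_re, Complex.sub_re, Complex.one_re]; linarith
    · simp only [Complex.mul_im, Complex.sub_im, Complex.one_im]; ring
  have h := three_mul_patternCount_le hω Complex.orthonormalBasisOneI.repr.symm V
  obtain hV | ⟨N, hN⟩ : V.card = 0 ∨ ∃ N, V.card = N + 1 := by
    cases hc : V.card with
    | zero => exact Or.inl rfl
    | succ N => exact Or.inr ⟨N, rfl⟩
  · rw [Finset.card_eq_zero.mp hV] at h ⊢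
    simp only [Finset.map_empty, Finset.sum_empty, Nat.le_zero, mul_eq_zero] at h
    rw [h.resolve_left (by norm_num)]
    norm_num
  · have h2 := sum_vertexCount_le hω
      (V.map Complex.orthonormalBasisOneI.repr.symm.toEquiv.toEmbedding)
      ((Finset.card_map _).trans hN)
    have h' := (Nat.cast_le (α := ℝ)).mpr h
    push_cast at h'
    rw [hN]
    push_cast
    linarith

theorem maxPatternCount_equilateralPattern_le (n : ℕ) :
    (maxPatternCount equilateralPattern n : ℝ) ≤ (4 * (n : ℝ) - 1) * ((n : ℝ) - 1) / 18 := by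
  have : Infinite Plane := Module.Free.infinite ℝ Plane
  obtain ⟨V, hV, h⟩ := (isGreatest_maxPatternCount equilateralPattern n).1
  rw [← h, ← hV]
  exact patternCount_equilateralPattern_le V

/-! ### Comparison with the older bound and conclusion -/

theorem floor_le_floor_sq_div_four (n : ℕ) :
    ⌊(4 * (n : ℝ) - 1) * ((n : ℝ) - 1) / 18⌋ ≤ ⌊((n : ℝ) - 1) ^ 2 / 4⌋ := by
  -- Without floors the two bounds differ by `(n - 1)(n - 7)/36`, which is nonnegative for `n ≥ 7`.
  rcases Nat.lt_or_ge n 7 with h | h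
  · interval_cases n <;> norm_num
  · have hn : (7 : ℝ) ≤ n := by exact_mod_cast h
    exact Int.floor_le_floor (by nlinarith)

theorem floor_lt_floor_sq_div_four {n : ℕ} (h : 9 ≤ n) :
    ⌊(4 * (n : ℝ) - 1) * ((n : ℝ) - 1) / 18⌋ < ⌊((n : ℝ) - 1) ^ 2 / 4⌋ := by
  -- The difference `(n - 1)(n - 7)/36` is at least 1 from `n = 11` on; for 9 and 10 only the floors
  -- separate the bounds.
  obtain rfl | rfl | h : n = 9 ∨ n = 10 ∨ 11 ≤ n := by omega
  · norm_num
  · norm_num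
  · have hn : (11 : ℝ) ≤ n := by exact_mod_cast h
    rw [Int.lt_iff_add_one_le, Int.le_floor]
    push_cast
    have := Int.floor_le ((4 * (n : ℝ) - 1) * ((n : ℝ) - 1) / 18)
    nlinarith

theorem theorem1 :
    -- every `n`-point subset of the plane determines at most `⌊(4n-1)(n-1)/18⌋` triangles
    (∀ (n : ℕ) (V : Finset Plane), V.card = n →
      (patternCount equilateralPattern V : ℤ) ≤ ⌊(4 * (n : ℝ) - 1) * ((n : ℝ) - 1) / 18⌋) ∧
    -- the same for the maximum over all `n`-point subsets
    (∀ n : ℕ, (maxPatternCount equilateralPattern n : ℤ) ≤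
      ⌊(4 * (n : ℝ) - 1) * ((n : ℝ) - 1) / 18⌋) ∧
    -- the asymptotic consequence, with the upper limit taken in the extended reals
    limsup (fun n : ℕ =>
      (((maxPatternCount equilateralPattern n : ℝ) / (n : ℝ) ^ 2 : ℝ) : EReal)) atTop
        ≤ ((2 / 9 : ℝ) : EReal) ∧
    -- comparison with the bound `⌊(n-1)²/4⌋`
    (∀ n : ℕ, ⌊(4 * (n : ℝ) - 1) * ((n : ℝ) - 1) / 18⌋ ≤ ⌊((n : ℝ) - 1) ^ 2 / 4⌋) ∧
    (∀ n : ℕ, 9 ≤ n →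
      ⌊(4 * (n : ℝ) - 1) * ((n : ℝ) - 1) / 18⌋ < ⌊((n : ℝ) - 1) ^ 2 / 4⌋) := by
  refine ⟨fun n V hV => ?_, fun n => ?_, ?_, floor_le_floor_sq_div_four,
    fun n hn => floor_lt_floor_sq_div_four hn⟩
  · rw [Int.le_floor, ← hV]
    exact_mod_cast patternCount_equilateralPattern_le V
  · rw [Int.le_floor]
    exact_mod_cast maxPatternCount_equilateralPattern_le n
  · refine limsup_le_of_le (by isBoundedDefault) ?_
    -- No limit is needed: the bound is already at most `2n²/9` for every `n ≥ 1`.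
    filter_upwards [eventually_ge_atTop 1] with n hn
    have hn' : (1 : ℝ) ≤ n := by exact_mod_cast hn
    rw [EReal.coe_le_coe_iff, div_le_iff₀ (by positivity)]
    have := maxPatternCount_equilateralPattern_le n
    nlinarith
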